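/- Let $\alpha,\beta>-1$, let $j\ge 0$ be an integer, let $\gamma\in\mathbb{R}$ and $M>0$, and let $\{M_n\}_{n\ge 0}$ be a sequence of nonnegative real numbers with $\lim_{n\to\infty}M_n n^{\gamma}=M$. For real polynomials $f,g$ put $$(f,g)=\int_{-1}^1 f(x)g(x)(1-x)^{\alpha}(1+x)^{\beta}\,dx,\qquad (f,g)_{S,n}=(f,g)+M_n f^{(j)}(1)g^{(j)}(1).$$ Let $P_n^{(\alpha,\beta)}$ be the Jacobi polynomial of degree $n$, i.e. the polynomial of degree $n$ that is orthogonal with respect to $(\cdot,\cdot)$ to all polynomials of degree less than $n$ and is normalized by $P_n^{(\alpha,\beta)}(1)=\frac{\Gamma(n+\alpha+1)}{\Gamma(n+1)\Gamma(\alpha+1)}$, and write $\|P_n^{(\alpha,\beta)}\|^2=(P_n^{(\alpha,\beta)},P_n^{(\alpha,\beta)})$. Let $Q_n$ be the polynomial of degree $n$ that has the same leading coefficient as $P_n^{(\alpha,\beta)}$ and is orthogonal with respect to $(\cdot,\cdot)_{S,n}$ to all polynomials of degree less than $n$. Then: (a) For every fixed integer $k\ge 0$ (the quotient being considered for $n\ge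 k$), $$\lim_{n\to\infty}\frac{Q_n^{(k)}(1)}{\bigl(P_n^{(\alpha,\beta)}\bigr)^{(k)}(1)}=\begin{cases}\dfrac{k-j}{\alpha+j+k+1}, & \gamma<2(\alpha+2j+1),\\[2mm] \theta_{\alpha,\beta,j,k}, & \gamma=2(\alpha+2j+1),\\[1mm] 1, & \gamma>2(\alpha+2j+1),\end{cases}$$ where $$\theta_{\alpha,\beta,j,k}=\frac{M(k-j)+\Gamma(\alpha+j+1)^2\,2^{\alpha+\beta+2j+1}(\alpha+2j+1)(\alpha+j+k+1)}{(\alpha+j+k+1)\left(M+\Gamma(\alpha+j+1)^2\,2^{\alpha+\beta+2j+1}(\alpha+2j+1)\right)}.$$ (b) $\displaystyle\lim_{n\to\infty}\frac{(Q_n,Q_n)_{S,n}}{\|P_n^{(\alpha,\beta)}\|^2}=1.$ -/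

import Mathlib

open Filter Topology Polynomial

noncomputable section

/-- The Jacobi inner product `∫_{-1}^{1} f(x) g(x) (1 - x)^α (1 + x)^β dx` on real polynomials. -/
def jacobiInner (α β : ℝ) (f g : ℝ[X]) : ℝ :=
  ∫ x in (-1 : ℝ)..1, f.eval x * g.eval x * (1 - x) ^ α * (1 + x) ^ β

/-- The discrete Jacobi--Sobolev inner product with mass `m`: the Jacobi inner product plus
`m f⁽ʲ⁾(1) g⁽ʲ⁾(1)`. -/
def sobolevInner (α β : ℝ) (j : ℕ) (m : ℝ) (f g : ℝ[X]) : ℝ :=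
  jacobiInner α β f g + m * (derivative^[j] f).eval 1 * (derivative^[j] g).eval 1

/-- `p` is an orthogonal polynomial of degree `n` for the form `B`: its degree is exactly `n` and
it is orthogonal to every polynomial of smaller degree. -/
def IsOrthogonalPoly (B : ℝ[X] → ℝ[X] → ℝ) (n : ℕ) (p : ℝ[X]) : Prop :=
  p.degree = n ∧ ∀ q : ℝ[X], q.degree < n → B p q = 0

/-- `p` is the Jacobi polynomial of degree `n`: the orthogonal polynomial of degree `n` for the
Jacobi inner product, normalized by `p(1) = Γ(n+α+1) / (Γ(n+1) Γ(α+1))`. -/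
def IsJacobiPoly (α β : ℝ) (n : ℕ) (p : ℝ[X]) : Prop :=
  IsOrthogonalPoly (jacobiInner α β) n p ∧
    p.eval 1 = Real.Gamma (n + α + 1) / (Real.Gamma (n + 1) * Real.Gamma (α + 1))

/-- The Jacobi polynomial `P_n^{(α,β)}`, that is, the polynomial satisfying `IsJacobiPoly`
(for `α, β > -1` there is exactly one). -/
def jacobiP (α β : ℝ) (n : ℕ) : ℝ[X] :=
  Classical.epsilon (IsJacobiPoly α β n)

/-- `q` is the Jacobi--Sobolev polynomial of degree `n` for the mass `m`: the orthogonal polynomial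
of degree `n` for the Sobolev inner product, with the leading coefficient of `P_n^{(α,β)}`. -/
def IsSobolevPoly (α β : ℝ) (j : ℕ) (m : ℝ) (n : ℕ) (q : ℝ[X]) : Prop :=
  IsOrthogonalPoly (sobolevInner α β j m) n q ∧
    q.leadingCoeff = (jacobiP α β n).leadingCoeff

/-- The Jacobi--Sobolev polynomial `Q_n^{(α,β,m)}`, that is, the polynomial satisfying
`IsSobolevPoly` (for `α, β > -1` and `m ≥ 0` there is exactly one). -/
def sobolevQ (α β : ℝ) (j : ℕ) (m : ℝ) (n : ℕ) : ℝ[X] :=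
  Classical.epsilon (IsSobolevPoly α β j m n)

/-- The limit constant `θ_{α,β,j,k}` of the critical case; it also depends on `M`. -/
def thetaConst (α β M : ℝ) (j k : ℕ) : ℝ :=
  (M * ((k : ℝ) - j) +
      Real.Gamma (α + j + 1) ^ 2 * (2 : ℝ) ^ (α + β + 2 * j + 1) * (α + 2 * j + 1) *
        (α + j + k + 1)) /
    ((α + j + k + 1) *
      (M + Real.Gamma (α + j + 1) ^ 2 * (2 : ℝ) ^ (α + β + 2 * j + 1) * (α + 2 * j + 1)))

end

/-!
Write `K_n` for the polynomial of degree `< n` representing `f ↦ f⁽ʲ⁾(1)` with respect to the Jacobi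
inner product. Adding the mass `m_n` is a rank-one perturbation of that form, so
`Q_n = P_n - m_n P_n⁽ʲ⁾(1) / (1 + x_n) • K_n` with `x_n = m_n K_n⁽ʲ⁾(1)`. Hence
`Q_n⁽ᵏ⁾(1) / P_n⁽ᵏ⁾(1) = 1 - r_n x_n / (1 + x_n)`, where
`r_n = P_n⁽ʲ⁾(1) K_n⁽ᵏ⁾(1) / (K_n⁽ʲ⁾(1) P_n⁽ᵏ⁾(1))` tends to `(α + 2j + 1) / (α + j + k + 1)` and
`x_n` is asymptotic to a positive multiple of `n ^ (2 (α + 2j + 1) - γ)`. The sign of the exponent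
decides between the three cases.

The asymptotics rest on Jacobi's differential equation: the derivatives of a solution satisfy an
equation of the same type with shifted parameters, and this evaluates both `P_n⁽ᵏ⁾(1)` and `‖P_n‖²`
in terms of Gamma functions.
-/

open Asymptotics

section BilinForm

variable {B : LinearMap.BilinForm ℝ ℝ[X]} {n : ℕ} {p q : ℝ[X]}

theorem IsOrthogonalPoly.apply_eq_zero (hp : IsOrthogonalPoly (fun f g => B f g) n p)
    (hq : q.degree < n) : B p q = 0 :=
  hp.2 q hq

theorem exists_isOrthogonalPoly (hB : B.toQuadraticMap.Anisotropic) (n : ℕ) :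
    ∃ p, IsOrthogonalPoly (fun f g => B f g) n p := by
  have : FiniteDimensional ℝ (degreeLT ℝ n) := (degreeLTEquiv ℝ n).symm.finiteDimensional
  let φ : degreeLT ℝ n →ₗ[ℝ] Module.Dual ℝ (degreeLT ℝ n) := B.restrict (degreeLT ℝ n)
  have hφ : Function.Injective φ :=
    (injective_iff_map_eq_zero φ).2 fun f hf => Subtype.ext (hB f (LinearMap.congr_fun hf f))
  obtain ⟨⟨q, hq⟩, hφq⟩ := (LinearMap.injective_iff_surjective_of_finrank_eq_finrank
    Subspace.dual_finrank_eq.symm).1 hφ ((B (X ^ n)).domRestrict (degreeLT ℝ n))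
  refine ⟨X ^ n - q, ?_, fun g hg => ?_⟩
  · rw [mem_degreeLT] at hq
    rw [degree_sub_eq_left_of_degree_lt] <;> simp [hq]
  · have hqg : B q g = B (X ^ n) g := LinearMap.congr_fun hφq ⟨g, mem_degreeLT.2 hg⟩
    change B (X ^ n - q) g = 0
    rw [map_sub, LinearMap.sub_apply, hqg, sub_self]

theorem IsOrthogonalPoly.smul (hp : IsOrthogonalPoly (fun f g => B f g) n p) {c : ℝ}
    (hc : c ≠ 0) : IsOrthogonalPoly (fun f g => B f g) n (c • p) := by
  refine ⟨?_, fun q hq => ?_⟩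
  · rw [degree_smul_of_smul_regular _ (IsSMulRegular.of_ne_zero hc), hp.1]
  · change B (c • p) q = 0
    rw [map_smul, LinearMap.smul_apply, hp.apply_eq_zero hq, smul_zero]

theorem IsOrthogonalPoly.eq_of_leadingCoeff_eq (hB : B.toQuadraticMap.Anisotropic)
    (hp : IsOrthogonalPoly (fun f g => B f g) n p) (hq : IsOrthogonalPoly (fun f g => B f g) n q)
    (h : p.leadingCoeff = q.leadingCoeff) : p = q := by
  have hp0 : p ≠ 0 := fun h0 => by simpa [h0] using hp.1
  have hd : (p - q).degree < n := hp.1 ▸ degree_sub_lt_left (hp.1.trans hq.1.symm) hp0 h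
  refine sub_eq_zero.1 (hB _ ?_)
  change B (p - q) (p - q) = 0
  conv_lhs => rw [map_sub B p q]
  rw [LinearMap.sub_apply, hp.apply_eq_zero hd, hq.apply_eq_zero hd, sub_self]

/-- The kernel polynomial `∑_{i < n} (L Pᵢ / B(Pᵢ, Pᵢ)) Pᵢ` of a functional `L`. When the `Pᵢ` are
orthogonal for `B`, it represents `L` on the polynomials of degree less than `n`; for `L` the
evaluation at a point it is the Christoffel--Darboux kernel with one variable frozen. -/
noncomputable def orthogonalKernel (B : LinearMap.BilinForm ℝ ℝ[X]) (L : ℝ[X] →ₗ[ℝ] ℝ)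
    (P : ℕ → ℝ[X]) (n : ℕ) : ℝ[X] :=
  ∑ i ∈ Finset.range n, (L (P i) / B (P i) (P i)) • P i

variable {L : ℝ[X] →ₗ[ℝ] ℝ} {P : ℕ → ℝ[X]}

theorem degree_orthogonalKernel_lt (hP : ∀ i, (P i).degree = i) (n : ℕ) :
    (orthogonalKernel B L P n).degree < n := by
  refine mem_degreeLT.1 (Submodule.sum_mem _ fun i hi => Submodule.smul_mem _ _ ?_)
  rw [mem_degreeLT, hP i]
  exact_mod_cast Finset.mem_range.1 hi

theorem apply_orthogonalKernel (L' : ℝ[X] →ₗ[ℝ] ℝ) (n : ℕ) :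
    L' (orthogonalKernel B L P n) =
      ∑ i ∈ Finset.range n, L (P i) * L' (P i) / B (P i) (P i) := by
  simp only [orthogonalKernel, map_sum, map_smul, smul_eq_mul, div_mul_eq_mul_div]

theorem orthogonalKernel_reproducing (hB : B.toQuadraticMap.Anisotropic) (hs : B.IsSymm)
    (hP : ∀ i, IsOrthogonalPoly (fun f g => B f g) i (P i)) (hq : q.degree < n) :
    B (orthogonalKernel B L P n) q = L q := by
  let S : Polynomial.Sequence ℝ := ⟨P, fun i => (hP i).1⟩
  have hS : q ∈ Submodule.span ℝ (S '' Set.Iio n) := by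
    rwa [S.span_degreeLT fun i _ => (leadingCoeff_ne_zero.2 (S.ne_zero i)).isUnit, mem_degreeLT]
  refine LinearMap.eqOn_span (f := B (orthogonalKernel B L P n)) (g := L) ?_ hS
  rintro _ ⟨k, hk, rfl⟩
  have hlt : ∀ {i l : ℕ}, i < l → B (P l) (P i) = 0 := fun {i l} hil =>
    (hP l).2 _ (by rw [(hP i).1]; exact_mod_cast hil)
  have hne : B (P k) (P k) ≠ 0 := fun h => S.ne_zero k (hB _ h)
  change B (orthogonalKernel B L P n) (P k) = L (P k)
  rw [hs.eq, apply_orthogonalKernel, Finset.sum_eq_single_of_mem k (Finset.mem_range.2 hk)]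
  · rw [mul_div_cancel_right₀ _ hne]
  · intro i _ hik
    rcases hik.lt_or_gt with h | h
    · rw [hlt h, mul_zero, zero_div]
    · rw [hs.eq, hlt h, mul_zero, zero_div]

theorem apply_orthogonalKernel_self_nonneg (hB : ∀ f, 0 ≤ B f f) (n : ℕ) :
    0 ≤ L (orthogonalKernel B L P n) := by
  rw [apply_orthogonalKernel]
  exact Finset.sum_nonneg fun i _ => div_nonneg (mul_self_nonneg _) (hB _)

/-- The form `B(f, g) + m L(f) L(g)`, the perturbation of `B` by the mass `m` at the functional `L`;
the discrete Sobolev inner products are the case where `L` evaluates a derivative at a point. -/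
noncomputable def massForm (B : LinearMap.BilinForm ℝ ℝ[X]) (L : ℝ[X] →ₗ[ℝ] ℝ) (m : ℝ) :
    LinearMap.BilinForm ℝ ℝ[X] :=
  B + m • LinearMap.BilinForm.linMulLin L L

variable {m : ℝ} {K : ℝ[X]}

theorem massForm_apply (f g : ℝ[X]) : massForm B L m f g = B f g + m * L f * L g := by
  simp [massForm, mul_assoc]

theorem massForm_anisotropic (hB : B.toQuadraticMap.PosDef) (hm : 0 ≤ m) :
    (massForm B L m).toQuadraticMap.Anisotropic := by
  intro f hf
  by_contra h
  have hpos : 0 < B f f := hB f h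
  have hmass : 0 ≤ m * L f * L f := by rw [mul_assoc]; exact mul_nonneg hm (mul_self_nonneg _)
  rw [LinearMap.BilinMap.toQuadraticMap_apply, massForm_apply] at hf
  linarith

/-- The polynomial `p - (m L(p) / (1 + m L(K))) K`, which is orthogonal for the form perturbed by a
mass `m` at `L` when `p` is orthogonal for the original form and `K` represents `L` there. -/
noncomputable def massModification (L : ℝ[X] →ₗ[ℝ] ℝ) (m : ℝ) (K p : ℝ[X]) : ℝ[X] :=
  p - (m * L p / (1 + m * L K)) • K

theorem apply_massModification (L' : ℝ[X] →ₗ[ℝ] ℝ) :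
    L' (massModification L m K p) = L' p - m * L p / (1 + m * L K) * L' K := by
  rw [massModification, map_sub, map_smul, smul_eq_mul]

theorem degree_smul_lt_of_degree_lt (hp : p.degree = n) (hK : K.degree < n) (c : ℝ) :
    (c • K).degree < p.degree :=
  hp ▸ (degree_smul_le c K).trans_lt hK

theorem leadingCoeff_massModification (hp : p.degree = n) (hK : K.degree < n) :
    (massModification L m K p).leadingCoeff = p.leadingCoeff :=
  leadingCoeff_sub_of_degree_lt (degree_smul_lt_of_degree_lt hp hK _)

theorem isOrthogonalPoly_massModification (hp : IsOrthogonalPoly (fun f g => B f g) n p)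
    (hK : K.degree < n) (hBK : ∀ q : ℝ[X], q.degree < n → B K q = L q) (hm : 1 + m * L K ≠ 0) :
    IsOrthogonalPoly (fun f g => massForm B L m f g) n (massModification L m K p) := by
  refine ⟨?_, fun q hq => ?_⟩
  · rw [massModification, degree_sub_eq_left_of_degree_lt (degree_smul_lt_of_degree_lt hp.1 hK _),
      hp.1]
  · change massForm B L m (massModification L m K p) q = 0
    rw [massForm_apply, apply_massModification, massModification, map_sub, map_smul,
      LinearMap.sub_apply, LinearMap.smul_apply, hp.apply_eq_zero hq, hBK q hq, smul_eq_mul]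
    field_simp
    ring

theorem massForm_massModification_self (hs : B.IsSymm)
    (hp : IsOrthogonalPoly (fun f g => B f g) n p) (hK : K.degree < n)
    (hBK : ∀ q : ℝ[X], q.degree < n → B K q = L q) (hm : 1 + m * L K ≠ 0) :
    massForm B L m (massModification L m K p) (massModification L m K p) =
      B p p + m * L p ^ 2 / (1 + m * L K) := by
  have hQ := isOrthogonalPoly_massModification hp hK hBK hm
  calc massForm B L m (massModification L m K p) (massModification L m K p)
      = massForm B L m (massModification L m K p) p := by
        nth_rw 2 [massModification]
        rw [map_sub, map_smul, hQ.apply_eq_zero hK, smul_zero, sub_zero]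
    _ = B p p + m * (L p - m * L p / (1 + m * L K) * L K) * L p := by
        have hKp : B K p = 0 := by rw [hs.eq, hp.apply_eq_zero hK]
        rw [massForm_apply, apply_massModification, massModification, map_sub, map_smul,
          LinearMap.sub_apply, LinearMap.smul_apply, hKp, smul_zero, sub_zero]
    _ = B p p + m * L p ^ 2 / (1 + m * L K) := by
        field_simp
        ring

theorem tendsto_apply_massModification_div {ι : Type*} {l : Filter ι} {L' : ℝ[X] →ₗ[ℝ] ℝ}
    {m : ι → ℝ} {K p : ι → ℝ[X]} {r τ : ℝ} (hp : ∀ᶠ i in l, L' (p i) ≠ 0)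
    (hK : ∀ᶠ i in l, L (K i) ≠ 0)
    (hr : Tendsto (fun i => L (p i) * L' (K i) / (L' (p i) * L (K i))) l (𝓝 r))
    (hτ : Tendsto (fun i => m i * L (K i) / (1 + m i * L (K i))) l (𝓝 τ)) :
    Tendsto (fun i => L' (massModification L (m i) (K i) (p i)) / L' (p i)) l
      (𝓝 (1 - r * τ)) := by
  refine ((hr.mul hτ).const_sub 1).congr' ?_
  filter_upwards [hp, hK] with i hpi hKi
  rw [apply_massModification, sub_div, div_self hpi]
  field_simp

end BilinForm

section JacobiInner

variable {α β : ℝ}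

theorem one_sub_rpow_mul_one_add_rpow_pos {x : ℝ} (hx : x ∈ Set.Ioo (-1 : ℝ) 1) :
    0 < (1 - x) ^ α * (1 + x) ^ β :=
  mul_pos (Real.rpow_pos_of_pos (by linarith [hx.2]) α)
    (Real.rpow_pos_of_pos (by linarith [hx.1]) β)

open MeasureTheory in
theorem intervalIntegrable_one_sub_rpow_mul_one_add_rpow (hα : -1 < α) (hβ : -1 < β) :
    IntervalIntegrable (fun x : ℝ => (1 - x) ^ α * (1 + x) ^ β) volume (-1) 1 := by
  have left_half : ∀ a b : ℝ, -1 < b →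
      IntervalIntegrable (fun x : ℝ => (1 - x) ^ a * (1 + x) ^ b) volume (-1) 0 := by
    intro a b hb
    refine IntervalIntegrable.continuousOn_mul ?_ ?_
    · have := (intervalIntegral.intervalIntegrable_rpow' (a := 0) (b := 1) hb).comp_add_left 1
      simpa using this
    · refine ContinuousOn.rpow_const (by fun_prop) fun x hx => Or.inl ?_
      rw [Set.uIcc_of_le (by norm_num)] at hx
      linarith [hx.2]
  have right_half := ((left_half β α hα).comp_sub_left 0).symm
  refine (left_half α β hβ).trans ?_
  simpa [mul_comm, ← sub_eq_add_neg] using right_half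

open MeasureTheory in
theorem intervalIntegrable_eval_mul_eval_mul_rpow (hα : -1 < α) (hβ : -1 < β) (f g : ℝ[X]) :
    IntervalIntegrable (fun x : ℝ => f.eval x * g.eval x * (1 - x) ^ α * (1 + x) ^ β)
      volume (-1) 1 := by
  have := (intervalIntegrable_one_sub_rpow_mul_one_add_rpow hα hβ).continuousOn_mul
    (g := fun x => f.eval x * g.eval x) (by fun_prop)
  simpa [mul_assoc] using this

theorem jacobiInner_comm (α β : ℝ) (f g : ℝ[X]) : jacobiInner α β f g = jacobiInner α β g f := by
  simp only [jacobiInner, mul_comm (f.eval _)]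

theorem jacobiInner_add_left (hα : -1 < α) (hβ : -1 < β) (f g h : ℝ[X]) :
    jacobiInner α β (f + g) h = jacobiInner α β f h + jacobiInner α β g h := by
  rw [jacobiInner, jacobiInner, jacobiInner, ← intervalIntegral.integral_add
    (intervalIntegrable_eval_mul_eval_mul_rpow hα hβ f h)
    (intervalIntegrable_eval_mul_eval_mul_rpow hα hβ g h)]
  simp only [eval_add, add_mul]

theorem jacobiInner_smul_left (α β c : ℝ) (f g : ℝ[X]) :
    jacobiInner α β (c • f) g = c * jacobiInner α β f g := by
  rw [jacobiInner, jacobiInner, ← intervalIntegral.integral_const_mul]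
  simp only [eval_smul, smul_eq_mul, mul_assoc]

/-- The Jacobi inner product as a bilinear form; the bounds on the exponents make the integral
converge, hence additive. -/
noncomputable def jacobiForm (hα : -1 < α) (hβ : -1 < β) : LinearMap.BilinForm ℝ ℝ[X] :=
  LinearMap.mk₂ ℝ (jacobiInner α β) (jacobiInner_add_left hα hβ) (jacobiInner_smul_left α β)
    (fun f g h => by
      rw [jacobiInner_comm, jacobiInner_add_left hα hβ, jacobiInner_comm _ _ g,
        jacobiInner_comm _ _ h])
    (fun c f g => by rw [jacobiInner_comm, jacobiInner_smul_left, jacobiInner_comm, smul_eq_mul])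

theorem jacobiForm_isSymm (hα : -1 < α) (hβ : -1 < β) : (jacobiForm hα hβ).IsSymm :=
  ⟨jacobiInner_comm α β⟩

open MeasureTheory Set in
theorem jacobiInner_self_pos (hα : -1 < α) (hβ : -1 < β) {f : ℝ[X]} (hf : f ≠ 0) :
    0 < jacobiInner α β f f := by
  have hint := intervalIntegrable_eval_mul_eval_mul_rpow hα hβ f f
  rw [jacobiInner]
  simp only [mul_assoc (f.eval _ * f.eval _)] at hint ⊢
  have hnonneg : 0 ≤ᵐ[volume.restrict (Ioc (-1 : ℝ) 1)]
      fun x => f.eval x * f.eval x * ((1 - x) ^ α * (1 + x) ^ β) := by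
    rw [← restrict_Ioo_eq_restrict_Ioc]
    exact (ae_restrict_mem measurableSet_Ioo).mono fun x hx =>
      mul_nonneg (mul_self_nonneg _) (one_sub_rpow_mul_one_add_rpow_pos hx).le
  have hsupport : Ioo (-1 : ℝ) 1 \ f.rootSet ℝ ⊆
      Function.support (fun x => f.eval x * f.eval x * ((1 - x) ^ α * (1 + x) ^ β)) ∩
        Ioc (-1) 1 := by
    rintro x ⟨hx, hroot⟩
    have hfx : f.eval x ≠ 0 := fun h => hroot (by simp [mem_rootSet, hf, h])
    exact ⟨mul_ne_zero (mul_self_ne_zero.2 hfx) (one_sub_rpow_mul_one_add_rpow_pos hx).ne',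
      Ioo_subset_Ioc_self hx⟩
  rw [intervalIntegral.integral_pos_iff_support_of_nonneg_ae'
    (by rwa [uIoc_of_le (by norm_num)]) hint]
  refine ⟨by norm_num, lt_of_lt_of_le ?_ (measure_mono hsupport)⟩
  rw [measure_sdiff_null ((f.rootSet_finite ℝ).measure_zero _)]
  simp

theorem jacobiForm_posDef (hα : -1 < α) (hβ : -1 < β) :
    (jacobiForm hα hβ).toQuadraticMap.PosDef :=
  fun _ hf => jacobiInner_self_pos hα hβ hf

theorem integral_rpow_mul_one_sub_rpow (hα : -1 < α) (hβ : -1 < β) :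
    ∫ x in (0 : ℝ)..1, x ^ α * (1 - x) ^ β = ProbabilityTheory.beta (α + 1) (β + 1) := by
  rw [ProbabilityTheory.beta_eq_betaIntegralReal _ _ (by linarith) (by linarith),
    Complex.betaIntegral, ← Complex.ofReal_re (∫ x in (0 : ℝ)..1, x ^ α * (1 - x) ^ β),
    ← intervalIntegral.integral_ofReal]
  refine congrArg Complex.re (intervalIntegral.integral_congr fun x hx => ?_)
  rw [Set.uIcc_of_le zero_le_one] at hx
  push_cast
  rw [Complex.ofReal_cpow hx.1, Complex.ofReal_cpow (by linarith [hx.2])]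
  push_cast
  simp only [add_sub_cancel_right]

theorem jacobiInner_one_one (hα : -1 < α) (hβ : -1 < β) :
    jacobiInner α β 1 1 = 2 ^ (α + β + 1) * ProbabilityTheory.beta (α + 1) (β + 1) := by
  have hsubst := intervalIntegral.mul_integral_comp_sub_mul
    (f := fun x : ℝ => (1 - x) ^ α * (1 + x) ^ β) (a := 0) (b := 1) 2 1
  have hweight : ∀ x ∈ Set.uIcc (0 : ℝ) 1, (1 - (1 - 2 * x)) ^ α * (1 + (1 - 2 * x)) ^ β =
      2 ^ (α + β) * (x ^ α * (1 - x) ^ β) := by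
    intro x hx
    rw [Set.uIcc_of_le zero_le_one] at hx
    rw [show 1 - (1 - 2 * x) = 2 * x by ring, show 1 + (1 - 2 * x) = 2 * (1 - x) by ring,
      Real.mul_rpow two_pos.le hx.1, Real.mul_rpow two_pos.le (by linarith [hx.2]),
      Real.rpow_add two_pos]
    ring
  rw [intervalIntegral.integral_congr hweight, intervalIntegral.integral_const_mul,
    integral_rpow_mul_one_sub_rpow hα hβ] at hsubst
  rw [show (1 : ℝ) - 2 * 1 = -1 by norm_num, mul_zero, sub_zero] at hsubst
  simp only [jacobiInner, eval_one, one_mul]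
  rw [← hsubst, Real.rpow_add_one two_ne_zero]
  ring

/-- The functional `f ↦ f⁽ᵏ⁾(x)` on polynomials. -/
noncomputable def derivEval (k : ℕ) (x : ℝ) : ℝ[X] →ₗ[ℝ] ℝ where
  toFun f := (derivative^[k] f).eval x
  map_add' f g := by rw [iterate_map_add, eval_add]
  map_smul' c f := by rw [iterate_derivative_smul, eval_smul, RingHom.id_apply]

theorem derivEval_apply (k : ℕ) (x : ℝ) (f : ℝ[X]) :
    derivEval k x f = (derivative^[k] f).eval x := rfl

end JacobiInner

section JacobiOperator

variable {α β : ℝ} {f p : ℝ[X]} {n : ℕ}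

/-- The differential operator `(1 - x²) f'' + (β - α - (α + β + 2) x) f'`, of which the Jacobi
polynomials are the eigenfunctions. -/
noncomputable def jacobiOp (α β : ℝ) (f : ℝ[X]) : ℝ[X] :=
  (1 - X ^ 2) * derivative (derivative f) + (C (β - α) - C (α + β + 2) * X) * derivative f

theorem hasDerivAt_derivative_mul_mul_weight (f g : ℝ[X]) {x : ℝ} (hx : x ∈ Set.Ioo (-1 : ℝ) 1) :
    HasDerivAt (fun x => (derivative f).eval x * g.eval x * ((1 - x) ^ (α + 1) *
        (1 + x) ^ (β + 1)))
      ((jacobiOp α β f).eval x * g.eval x * (1 - x) ^ α * (1 + x) ^ β +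
        (derivative f).eval x * (derivative g).eval x * (1 - x) ^ (α + 1) *
          (1 + x) ^ (β + 1)) x := by
  have hsub : 0 < 1 - x := by linarith [hx.2]
  have hadd : 0 < 1 + x := by linarith [hx.1]
  have hder_sub : HasDerivAt (fun y : ℝ => (1 - y) ^ (α + 1)) (-1 * (α + 1) * (1 - x) ^ α) x := by
    simpa using ((hasDerivAt_id x).const_sub 1).rpow_const (p := α + 1) (Or.inl hsub.ne')
  have hder_add : HasDerivAt (fun y : ℝ => (1 + y) ^ (β + 1)) (1 * (β + 1) * (1 + x) ^ β) x := by
    simpa using ((hasDerivAt_id x).const_add 1).rpow_const (p := β + 1) (Or.inl hadd.ne')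
  refine ((((derivative f).hasDerivAt x).mul (g.hasDerivAt x)).mul
    (hder_sub.mul hder_add)).congr_deriv ?_
  simp only [Pi.mul_apply, Real.rpow_add_one hsub.ne', Real.rpow_add_one hadd.ne', jacobiOp,
    eval_add, eval_mul, eval_sub, eval_one, eval_pow, eval_X, eval_C]
  ring

theorem jacobiInner_jacobiOp (hα : -1 < α) (hβ : -1 < β) (f g : ℝ[X]) :
    jacobiInner α β (jacobiOp α β f) g =
      -jacobiInner (α + 1) (β + 1) (derivative f) (derivative g) := by
  have hint := intervalIntegrable_eval_mul_eval_mul_rpow hα hβ (jacobiOp α β f) g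
  have hint' := intervalIntegrable_eval_mul_eval_mul_rpow (α := α + 1) (β := β + 1)
    (by linarith) (by linarith) (derivative f) (derivative g)
  have hcont : ContinuousOn (fun x => (derivative f).eval x * g.eval x *
      ((1 - x) ^ (α + 1) * (1 + x) ^ (β + 1))) (Set.Icc (-1) 1) := by
    refine ContinuousOn.mul (by fun_prop) (ContinuousOn.mul ?_ ?_)
    · exact ContinuousOn.rpow_const (by fun_prop) fun x _ => Or.inr (by linarith)
    · exact ContinuousOn.rpow_const (by fun_prop) fun x _ => Or.inr (by linarith)
  have hparts := intervalIntegral.integral_eq_sub_of_hasDerivAt_of_le (by norm_num) hcont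
    (fun x hx => hasDerivAt_derivative_mul_mul_weight f g hx) (hint.add hint')
  rw [intervalIntegral.integral_add hint hint', sub_self, add_neg_cancel,
    Real.zero_rpow (by linarith : α + 1 ≠ 0), Real.zero_rpow (by linarith : β + 1 ≠ 0)] at hparts
  simp only [zero_mul, mul_zero, sub_zero] at hparts
  exact eq_neg_of_add_eq_zero_left hparts

theorem jacobiInner_jacobiOp_comm (hα : -1 < α) (hβ : -1 < β) (f g : ℝ[X]) :
    jacobiInner α β (jacobiOp α β f) g = jacobiInner α β f (jacobiOp α β g) := by
  rw [jacobiInner_jacobiOp hα hβ, jacobiInner_comm _ _ f, jacobiInner_jacobiOp hα hβ,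
    jacobiInner_comm]

theorem coeff_jacobiOp (α β : ℝ) (f : ℝ[X]) (m : ℕ) :
    (jacobiOp α β f).coeff m = (m + 2) * (m + 1) * f.coeff (m + 2) +
      (β - α) * (m + 1) * f.coeff (m + 1) - m * (m + α + β + 1) * f.coeff m := by
  have h : jacobiOp α β f = derivative (derivative f) - X * (X * derivative (derivative f)) +
      (C (β - α) * derivative f - C (α + β + 2) * (X * derivative f)) := by
    rw [jacobiOp]; ring
  rw [h]
  rcases m with _ | _ | m <;>
    simp only [coeff_add, coeff_sub, coeff_C_mul, coeff_X_mul_zero, coeff_X_mul,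
      coeff_derivative] <;>
    push_cast <;> ring

theorem degree_jacobiOp_lt (hf : f.degree < n) : (jacobiOp α β f).degree < n := by
  rw [degree_lt_iff_coeff_zero] at hf ⊢
  intro m hm
  rw [coeff_jacobiOp, hf m hm, hf (m + 1) (by omega), hf (m + 2) (by omega)]
  ring

theorem degree_jacobiOp_add_smul_lt (hf : f.degree = n) :
    (jacobiOp α β f + ((n : ℝ) * (n + α + β + 1)) • f).degree < n := by
  have hf' : ∀ m, n + 1 ≤ m → f.coeff m = 0 := by
    rw [← degree_lt_iff_coeff_zero, hf]; exact_mod_cast n.lt_succ_self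
  rw [degree_lt_iff_coeff_zero]
  intro m hm
  rw [coeff_add, coeff_jacobiOp, coeff_smul, hf' (m + 1) (by omega), hf' (m + 2) (by omega)]
  rcases hm.eq_or_lt with rfl | h
  · simp
  · simp [hf' m h]

/-- The eigenvalue equation `(1 - x²) p'' + (β - α - (α + β + 2) x) p' = -ν (ν + α + β + 1) p`,
the form in which Jacobi's differential equation passes to the derivatives of `p`. -/
def IsJacobiEigenpoly (α β ν : ℝ) (p : ℝ[X]) : Prop :=
  jacobiOp α β p = (-(ν * (ν + α + β + 1))) • p

theorem IsOrthogonalPoly.isJacobiEigenpoly (hα : -1 < α) (hβ : -1 < β)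
    (hp : IsOrthogonalPoly (jacobiInner α β) n p) : IsJacobiEigenpoly α β n p := by
  set r := jacobiOp α β p + ((n : ℝ) * (n + α + β + 1)) • p with hr
  have hd : r.degree < n := degree_jacobiOp_add_smul_lt hp.1
  have hself : jacobiInner α β r r = 0 := by
    nth_rw 1 [hr]
    rw [jacobiInner_add_left hα hβ, jacobiInner_smul_left, hp.2 r hd,
      jacobiInner_jacobiOp_comm hα hβ, hp.2 _ (degree_jacobiOp_lt hd), mul_zero, add_zero]
  have hr0 : r = 0 := by
    by_contra h
    exact (jacobiInner_self_pos hα hβ h).ne' hself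
  rw [IsJacobiEigenpoly, neg_smul]
  exact eq_neg_of_add_eq_zero_left hr0

end JacobiOperator

section Eigenpolynomials

variable {α β ν : ℝ} {p : ℝ[X]} {n : ℕ}

theorem derivative_jacobiOp (α β : ℝ) (f : ℝ[X]) :
    derivative (jacobiOp α β f) =
      jacobiOp (α + 1) (β + 1) (derivative f) - (α + β + 2) • derivative f := by
  simp only [jacobiOp, derivative_add, derivative_sub, derivative_mul, derivative_one,
    derivative_X_sq, derivative_C, derivative_X]
  simp only [smul_eq_C_mul, C_add, C_sub, C_1, C_ofNat]
  ring

theorem isJacobiEigenpoly_derivative (hp : IsJacobiEigenpoly α β ν p) :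
    IsJacobiEigenpoly (α + 1) (β + 1) (ν - 1) (derivative p) := by
  have h := derivative_jacobiOp α β p
  rw [hp, derivative_smul] at h
  rw [IsJacobiEigenpoly, sub_eq_iff_eq_add.1 h.symm, ← add_smul]
  ring_nf

theorem isJacobiEigenpoly_iterate_derivative (hp : IsJacobiEigenpoly α β ν p) (k : ℕ) :
    IsJacobiEigenpoly (α + k) (β + k) (ν - k) (derivative^[k] p) := by
  induction k with
  | zero => simpa using hp
  | succ k ih =>
    rw [Function.iterate_succ_apply', Nat.cast_succ, ← add_assoc, ← add_assoc, ← sub_sub]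
    exact isJacobiEigenpoly_derivative ih

theorem IsJacobiEigenpoly.eval_one_derivative (hp : IsJacobiEigenpoly α β ν p) :
    2 * (α + 1) * (derivative p).eval 1 = ν * (ν + α + β + 1) * p.eval 1 := by
  have := congrArg (eval 1) hp
  simp only [jacobiOp, eval_add, eval_mul, eval_sub, eval_one, eval_pow, eval_X, eval_C, eval_smul,
    smul_eq_mul] at this
  linarith

theorem IsJacobiEigenpoly.jacobiInner_derivative_self (hα : -1 < α) (hβ : -1 < β)
    (hp : IsJacobiEigenpoly α β ν p) :
    jacobiInner (α + 1) (β + 1) (derivative p) (derivative p) =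
      ν * (ν + α + β + 1) * jacobiInner α β p p := by
  have := jacobiInner_jacobiOp hα hβ p p
  rw [hp, jacobiInner_smul_left] at this
  linarith

theorem IsJacobiEigenpoly.prod_mul_derivEval_one (hp : IsJacobiEigenpoly α β ν p) (k : ℕ) :
    (∏ i ∈ Finset.range k, 2 * (α + 1 + i)) * derivEval k 1 p =
      (∏ i ∈ Finset.range k, (ν - i) * (ν + α + β + 1 + i)) * p.eval 1 := by
  induction k with
  | zero => simp [derivEval_apply]
  | succ k ih =>
    have hk := (isJacobiEigenpoly_iterate_derivative hp k).eval_one_derivative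
    rw [← Function.iterate_succ_apply' derivative, ← derivEval_apply,
      ← derivEval_apply] at hk
    rw [Finset.prod_range_succ, Finset.prod_range_succ]
    linear_combination (∏ i ∈ Finset.range k, 2 * (α + 1 + i)) * hk +
      (ν - k) * (ν + α + β + 1 + k) * ih

theorem IsJacobiEigenpoly.jacobiInner_iterate_derivative_self (hα : -1 < α) (hβ : -1 < β)
    (hp : IsJacobiEigenpoly α β ν p) (k : ℕ) :
    jacobiInner (α + k) (β + k) (derivative^[k] p) (derivative^[k] p) =
      (∏ i ∈ Finset.range k, (ν - i) * (ν + α + β + 1 + i)) * jacobiInner α β p p := by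
  induction k with
  | zero => simp
  | succ k ih =>
    have : (0 : ℝ) ≤ k := k.cast_nonneg
    rw [Function.iterate_succ_apply', Nat.cast_succ, ← add_assoc, ← add_assoc,
      (isJacobiEigenpoly_iterate_derivative hp k).jacobiInner_derivative_self
        (by linarith) (by linarith), ih, Finset.prod_range_succ]
    ring

theorem iterate_derivative_eq_C_of_degree_eq (hp : p.degree = n) :
    derivative^[n] p = C (n.factorial * p.leadingCoeff) := by
  have hn : p.natDegree = n := natDegree_eq_of_degree_eq_some hp
  have h0 : (derivative^[n] p).natDegree ≤ 0 :=
    (natDegree_iterate_derivative p n).trans (by rw [hn, Nat.sub_self])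
  rw [eq_C_of_natDegree_le_zero h0, coeff_iterate_derivative, zero_add, Nat.descFactorial_self,
    nsmul_eq_mul, leadingCoeff, hn]

theorem IsJacobiEigenpoly.eval_one_ne_zero (hα : -1 < α) (hp : IsJacobiEigenpoly α β ν p)
    (h0 : p ≠ 0) : p.eval 1 ≠ 0 := by
  intro h
  have hprod := hp.prod_mul_derivEval_one p.natDegree
  rw [h, mul_zero, derivEval_apply,
    iterate_derivative_eq_C_of_degree_eq (degree_eq_natDegree h0), eval_C] at hprod
  have hne : ∏ i ∈ Finset.range p.natDegree, 2 * (α + 1 + i) ≠ 0 :=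
    Finset.prod_ne_zero_iff.2 fun i _ => by
      have : (0 : ℝ) ≤ i := i.cast_nonneg
      exact (by linarith : 0 < 2 * (α + 1 + i)).ne'
  have hlead : (p.natDegree.factorial : ℝ) * p.leadingCoeff ≠ 0 :=
    mul_ne_zero (Nat.cast_ne_zero.2 p.natDegree.factorial_ne_zero) (leadingCoeff_ne_zero.2 h0)
  exact mul_ne_zero hne hlead hprod

end Eigenpolynomials

section JacobiPolynomials

variable {α β : ℝ}

theorem prod_range_add_natCast {s : ℝ} (hs : 0 < s) (n : ℕ) :
    ∏ i ∈ Finset.range n, (s + i) = Real.Gamma (n + s) / Real.Gamma s := by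
  induction n with
  | zero => simp [(Real.Gamma_pos_of_pos hs).ne']
  | succ n ih =>
    rw [Finset.prod_range_succ, ih, Nat.cast_succ, add_right_comm,
      Real.Gamma_add_one (by positivity)]
    ring

theorem prod_range_natCast_sub (n : ℕ) :
    ∏ i ∈ Finset.range n, ((n : ℝ) - i) = n.factorial := by
  rw [← Nat.descFactorial_self, Nat.descFactorial_eq_prod_range, Nat.cast_prod]
  exact Finset.prod_congr rfl fun i hi => (Nat.cast_sub (Finset.mem_range.1 hi).le).symm

theorem isJacobiPoly_jacobiP (hα : -1 < α) (hβ : -1 < β) (n : ℕ) :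
    IsJacobiPoly α β n (jacobiP α β n) := by
  refine Classical.epsilon_spec (p := IsJacobiPoly α β n) ?_
  obtain ⟨p, hp⟩ := exists_isOrthogonalPoly (jacobiForm_posDef hα hβ).anisotropic n
  have hp0 : p ≠ 0 := fun h => by simpa [h] using hp.1
  have hp1 : p.eval 1 ≠ 0 :=
    IsJacobiEigenpoly.eval_one_ne_zero hα (IsOrthogonalPoly.isJacobiEigenpoly hα hβ hp) hp0
  set v := Real.Gamma (n + α + 1) / (Real.Gamma (n + 1) * Real.Gamma (α + 1))
  have hv0 : v ≠ 0 := by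
    have : (0 : ℝ) ≤ n := n.cast_nonneg
    exact div_ne_zero (Real.Gamma_pos_of_pos (by linarith)).ne'
      (mul_pos (Real.Gamma_pos_of_pos (by linarith)) (Real.Gamma_pos_of_pos (by linarith))).ne'
  exact ⟨(v / p.eval 1) • p, hp.smul (div_ne_zero hv0 hp1),
    by rw [eval_smul, smul_eq_mul, div_mul_cancel₀ _ hp1]⟩

theorem isOrthogonalPoly_jacobiP (hα : -1 < α) (hβ : -1 < β) (n : ℕ) :
    IsOrthogonalPoly (fun f g => jacobiForm hα hβ f g) n (jacobiP α β n) :=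
  (isJacobiPoly_jacobiP hα hβ n).1

theorem isJacobiEigenpoly_jacobiP (hα : -1 < α) (hβ : -1 < β) (n : ℕ) :
    IsJacobiEigenpoly α β n (jacobiP α β n) :=
  IsOrthogonalPoly.isJacobiEigenpoly hα hβ (isOrthogonalPoly_jacobiP hα hβ n)

theorem eval_one_jacobiP (hα : -1 < α) (hβ : -1 < β) (n : ℕ) :
    (jacobiP α β n).eval 1 = Real.Gamma (n + (α + 1)) / (n.factorial * Real.Gamma (α + 1)) := by
  rw [(isJacobiPoly_jacobiP hα hβ n).2, Real.Gamma_nat_eq_factorial, add_assoc]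

theorem derivEval_one_jacobiP (hα : -1 < α) (hβ : -1 < β) (k n : ℕ) :
    derivEval k 1 (jacobiP α β n) =
      (∏ i ∈ Finset.range k, ((n : ℝ) - i) * (n + α + β + 1 + i)) *
        (Real.Gamma (n + (α + 1)) / n.factorial) / (2 ^ k * Real.Gamma (k + (α + 1))) := by
  have hα1 : 0 < α + 1 := by linarith
  have hprod := (isJacobiEigenpoly_jacobiP hα hβ n).prod_mul_derivEval_one k
  have hΓ := Real.Gamma_pos_of_pos hα1
  have hΓk : 0 < Real.Gamma (k + (α + 1)) := Real.Gamma_pos_of_pos (by positivity)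
  rw [Finset.prod_mul_distrib, Finset.prod_const, Finset.card_range,
    prod_range_add_natCast hα1, eval_one_jacobiP hα hβ] at hprod
  field_simp at hprod ⊢
  linear_combination hprod

theorem derivEval_self_one_jacobiP (hα : -1 < α) (hβ : -1 < β) {n : ℕ} (hn : n ≠ 0) :
    derivEval n 1 (jacobiP α β n) =
      Real.Gamma (n + (n + α + β + 1)) / (2 ^ n * Real.Gamma (n + α + β + 1)) := by
  have hn1 : (1 : ℝ) ≤ n := Nat.one_le_cast.2 (Nat.one_le_iff_ne_zero.2 hn)
  have hΓ : Real.Gamma (n + (α + 1)) ≠ 0 := (Real.Gamma_pos_of_pos (by linarith)).ne'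
  rw [derivEval_one_jacobiP hα hβ, Finset.prod_mul_distrib, prod_range_natCast_sub,
    prod_range_add_natCast (by linarith)]
  field_simp

theorem jacobiInner_jacobiP_self (hα : -1 < α) (hβ : -1 < β) {n : ℕ} (hn : n ≠ 0) :
    jacobiInner α β (jacobiP α β n) (jacobiP α β n) =
      2 ^ (α + β + 1) * Real.Gamma (n + (α + 1)) * Real.Gamma (n + (β + 1)) /
        ((2 * n + (α + β + 1)) * n.factorial * Real.Gamma (n + (α + β + 1))) := by
  have hn1 : (1 : ℝ) ≤ n := Nat.one_le_cast.2 (Nat.one_le_iff_ne_zero.2 hn)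
  have hs : 0 < (n : ℝ) + α + β + 1 := by linarith
  have hnorm := (isJacobiEigenpoly_jacobiP hα hβ n).jacobiInner_iterate_derivative_self hα hβ n
  have hconst : derivative^[n] (jacobiP α β n) = derivEval n 1 (jacobiP α β n) • 1 := by
    rw [derivEval_apply, iterate_derivative_eq_C_of_degree_eq (isJacobiPoly_jacobiP hα hβ n).1.1,
      eval_C, smul_eq_C_mul, mul_one]
  have hΓ : 0 < Real.Gamma (n + α + β + 1) := Real.Gamma_pos_of_pos hs
  have hΓ' : 0 < Real.Gamma (n + (n + α + β + 1)) := Real.Gamma_pos_of_pos (by linarith)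
  have hΓsucc : Real.Gamma (n + (n + α + β + 1) + 1) =
      (2 * n + (α + β + 1)) * Real.Gamma (n + (n + α + β + 1)) := by
    rw [Real.Gamma_add_one (by linarith)]
    ring
  have hpow : (2 : ℝ) ^ (α + n + (β + n) + 1) = 2 ^ n * 2 ^ n * 2 ^ (α + β + 1) := by
    rw [← Real.rpow_natCast, ← Real.rpow_add two_pos, ← Real.rpow_add two_pos]
    ring_nf
  rw [hconst, jacobiInner_smul_left, jacobiInner_comm, jacobiInner_smul_left,
    jacobiInner_one_one (by linarith) (by linarith), ProbabilityTheory.beta,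
    derivEval_self_one_jacobiP hα hβ hn, Finset.prod_mul_distrib, prod_range_natCast_sub,
    prod_range_add_natCast hs, hpow,
    show α + n + 1 + (β + n + 1) = n + (n + α + β + 1) + 1 by ring, hΓsucc,
    show α + n + 1 = n + (α + 1) by ring,
    show β + n + 1 = n + (β + 1) by ring] at hnorm
  rw [show (n : ℝ) + (α + β + 1) = n + α + β + 1 by ring]
  have : 2 * (n : ℝ) + (α + β + 1) ≠ 0 := by linarith
  field_simp at hnorm ⊢
  linear_combination -hnorm

end JacobiPolynomials

section Asymptotics

theorem isEquivalent_natCast_add_const (c : ℝ) :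
    (fun n : ℕ => (n : ℝ) + c) ~[atTop] fun n : ℕ => (n : ℝ) :=
  IsEquivalent.refl.add_isLittleO
    ((isLittleO_const_id_atTop c).comp_tendsto tendsto_natCast_atTop_atTop)

theorem isEquivalent_Gamma_natCast_add (s : ℝ) :
    (fun n : ℕ => Real.Gamma (n + s)) ~[atTop] fun n : ℕ => n.factorial * (n : ℝ) ^ (s - 1) := by
  -- Euler's limit formula needs `1 < s`; the functional equation shifts any `s` there.
  suffices H : ∀ d : ℕ, ∀ s : ℝ, 1 < s + d → (fun n : ℕ => Real.Gamma (n + s)) ~[atTop]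
      fun n : ℕ => n.factorial * (n : ℝ) ^ (s - 1) by
    obtain ⟨d, hd⟩ := exists_nat_gt (1 - s)
    exact H d s (by linarith)
  intro d
  induction d with
  | zero =>
    intro s hs
    have hs : 0 < s - 1 := by simpa using hs
    have hΓ := (Real.Gamma_pos_of_pos hs).ne'
    have hseq : (fun n : ℕ => Real.Gamma (s - 1)) ~[atTop] Real.GammaSeq (s - 1) :=
      ((isEquivalent_const_iff_tendsto hΓ).2 (Real.GammaSeq_tendsto_Gamma (s - 1))).symm
    refine ((hseq.mul (IsEquivalent.refl (u := fun n : ℕ => Real.Gamma (n + s)))).div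
      (IsEquivalent.refl (u := fun _ : ℕ => Real.Gamma (s - 1)))).congr_left ?_ |>.congr_right ?_
    · exact .of_forall fun n => mul_div_cancel_left₀ _ hΓ
    · filter_upwards with n
      have hΓn : Real.Gamma (n + s) ≠ 0 :=
        (Real.Gamma_pos_of_pos (by linarith [n.cast_nonneg (α := ℝ)])).ne'
      simp only [Pi.div_apply, Pi.mul_apply]
      rw [Real.GammaSeq, prod_range_add_natCast hs, Nat.cast_succ,
        show (n : ℝ) + 1 + (s - 1) = n + s by ring]
      field_simp
  | succ d ih =>
    intro s hs
    have h := (ih (s + 1) (by push_cast at hs; linarith)).div (isEquivalent_natCast_add_const s)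
    refine (h.congr_left ?_).congr_right ?_
    · filter_upwards [tendsto_natCast_atTop_atTop.eventually_gt_atTop (-s)] with n hn
      have hns : (n : ℝ) + s ≠ 0 := by linarith
      rw [Pi.div_apply, ← add_assoc, Real.Gamma_add_one hns, mul_div_cancel_left₀ _ hns]
    · filter_upwards [eventually_ne_atTop 0] with n hn
      have hn : (n : ℝ) ≠ 0 := Nat.cast_ne_zero.2 hn
      rw [Pi.div_apply, add_sub_right_comm, Real.rpow_add_one hn]
      field_simp

theorem isEquivalent_natCast_add_one_rpow_sub_rpow {s : ℝ} (hs : s + 1 ≠ 0) :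
    (fun n : ℕ => ((n : ℝ) + 1) ^ (s + 1) - (n : ℝ) ^ (s + 1)) ~[atTop]
      fun n : ℕ => (s + 1) * (n : ℝ) ^ s := by
  have hd : HasDerivAt (fun x : ℝ => x ^ (s + 1)) (s + 1) 1 := by
    simpa using Real.hasDerivAt_rpow_const (x := 1) (p := s + 1) (Or.inl one_ne_zero)
  have ht : Tendsto (fun n : ℕ => (n : ℝ)⁻¹) atTop (𝓝[≠] 0) :=
    tendsto_nhdsWithin_iff.2 ⟨tendsto_inv_atTop_nhds_zero_nat,
      (eventually_ne_atTop 0).mono fun n hn => inv_ne_zero (Nat.cast_ne_zero.2 hn)⟩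
  have hslope := (isEquivalent_const_iff_tendsto hs).2
    ((hasDerivAt_iff_tendsto_slope_zero.1 hd).comp ht)
  refine (hslope.mul (IsEquivalent.refl (u := fun n : ℕ => (n : ℝ) ^ s))).congr_left ?_
  filter_upwards [eventually_ne_atTop 0] with n hn
  have hn : 0 < (n : ℝ) := Nat.cast_pos.2 (Nat.pos_of_ne_zero hn)
  have hinv : (1 : ℝ) + (n : ℝ)⁻¹ = (n + 1) / n := by field_simp
  simp only [Pi.mul_apply, Function.comp_apply, inv_inv, smul_eq_mul, Real.one_rpow, hinv]
  rw [Real.div_rpow (by positivity) hn.le, Real.rpow_add_one hn.ne' s]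
  field_simp

theorem isEquivalent_sum_range_of_isEquivalent {a g : ℕ → ℝ} (h : a ~[atTop] g)
    (hg : ∀ n, 0 ≤ g n) (hsum : Tendsto (fun n => ∑ i ∈ Finset.range n, g i) atTop atTop) :
    (fun n => ∑ i ∈ Finset.range n, a i) ~[atTop] fun n => ∑ i ∈ Finset.range n, g i :=
  (h.isLittleO.sum_range hg hsum).congr_left fun n => by
    simp only [Pi.sub_apply, Finset.sum_sub_distrib]

theorem isEquivalent_sum_range_rpow {a : ℕ → ℝ} {s c : ℝ} (hs : -1 < s) (hc : c ≠ 0)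
    (ha : a ~[atTop] fun n : ℕ => c * (n : ℝ) ^ s) :
    (fun n => ∑ i ∈ Finset.range n, a i) ~[atTop] fun n : ℕ => c / (s + 1) * (n : ℝ) ^ (s + 1) := by
  have hs1 : 0 < s + 1 := by linarith
  set g : ℕ → ℝ := fun n => ((n : ℝ) + 1) ^ (s + 1) - (n : ℝ) ^ (s + 1) with hg
  have hsum (n : ℕ) : ∑ i ∈ Finset.range n, g i = (n : ℝ) ^ (s + 1) := by
    simpa [hg, Real.zero_rpow hs1.ne'] using
      Finset.sum_range_sub (fun i : ℕ => (i : ℝ) ^ (s + 1)) n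
  have hag : (fun n => (s + 1) / c * a n) ~[atTop] g := by
    refine ((IsEquivalent.refl (u := fun _ : ℕ => (s + 1) / c)).mul ha).congr_right ?_ |>.trans
      (isEquivalent_natCast_add_one_rpow_sub_rpow hs1.ne').symm
    filter_upwards with n
    rw [Pi.mul_apply]
    field_simp
  have hinf : Tendsto (fun n => ∑ i ∈ Finset.range n, g i) atTop atTop := by
    simp only [hsum]
    exact (tendsto_rpow_atTop hs1).comp tendsto_natCast_atTop_atTop
  have hg0 (n : ℕ) : 0 ≤ g n :=
    sub_nonneg.2 (Real.rpow_le_rpow n.cast_nonneg (by linarith) hs1.le)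
  have h := (IsEquivalent.refl (u := fun _ : ℕ => c / (s + 1))).mul
    (isEquivalent_sum_range_of_isEquivalent hag hg0 hinf)
  simp only [hsum, ← Finset.mul_sum] at h
  refine h.congr_left (.of_forall fun n => ?_)
  rw [Pi.mul_apply]
  field_simp

theorem eventually_ne_zero_of_isEquivalent_mul_rpow {u : ℕ → ℝ} {c s : ℝ} (hc : c ≠ 0)
    (hu : u ~[atTop] fun n : ℕ => c * (n : ℝ) ^ s) : ∀ᶠ n in atTop, u n ≠ 0 := by
  filter_upwards [hu.isTheta.eq_zero_iff, eventually_gt_atTop 0] with n hn hn0 hun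
  have hpos : 0 < (n : ℝ) ^ s := Real.rpow_pos_of_pos (Nat.cast_pos.2 hn0) s
  exact mul_ne_zero hc hpos.ne' (hn.1 hun)

theorem isEquivalent_mul_rpow_of_tendsto {u : ℕ → ℝ} {γ M : ℝ} (hM : M ≠ 0)
    (hu : Tendsto (fun n : ℕ => u n * (n : ℝ) ^ γ) atTop (𝓝 M)) :
    u ~[atTop] fun n : ℕ => M * (n : ℝ) ^ (-γ) := by
  refine (((isEquivalent_const_iff_tendsto hM).2 hu).mul
    (IsEquivalent.refl (u := fun n : ℕ => (n : ℝ) ^ (-γ)))).congr_left ?_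
  filter_upwards [eventually_gt_atTop 0] with n hn
  rw [Pi.mul_apply, mul_assoc, ← Real.rpow_add (Nat.cast_pos.2 hn), add_neg_cancel,
    Real.rpow_zero, mul_one]

theorem tendsto_div_one_add_self_atTop : Tendsto (fun x : ℝ => x / (1 + x)) atTop (𝓝 1) := by
  have h : Tendsto (fun x : ℝ => 1 - (1 + x)⁻¹) atTop (𝓝 (1 - 0)) :=
    (tendsto_inv_atTop_zero.comp (tendsto_atTop_add_const_left _ 1 tendsto_id)).const_sub 1
  rw [sub_zero] at h
  refine h.congr' ?_
  filter_upwards [eventually_gt_atTop 0] with x hx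
  field_simp
  ring

theorem tendsto_div_one_add {ι : Type*} {l : Filter ι} {u : ι → ℝ} {t : ℝ} (ht : 1 + t ≠ 0)
    (hu : Tendsto u l (𝓝 t)) : Tendsto (fun i => u i / (1 + u i)) l (𝓝 (t / (1 + t))) :=
  hu.div (hu.const_add 1) ht

section MulRpow

variable {u : ℕ → ℝ} {c s : ℝ}

theorem tendsto_div_one_add_of_isEquivalent_mul_rpow_of_pos (hc : 0 < c) (hs : 0 < s)
    (hu : u ~[atTop] fun n : ℕ => c * (n : ℝ) ^ s) :
    Tendsto (fun n => u n / (1 + u n)) atTop (𝓝 1) :=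
  tendsto_div_one_add_self_atTop.comp (hu.symm.tendsto_atTop
    (((tendsto_rpow_atTop hs).comp tendsto_natCast_atTop_atTop).const_mul_atTop hc))

theorem tendsto_div_one_add_of_isEquivalent_mul_rpow_of_neg (hs : s < 0)
    (hu : u ~[atTop] fun n : ℕ => c * (n : ℝ) ^ s) :
    Tendsto (fun n => u n / (1 + u n)) atTop (𝓝 0) := by
  have hpow := (tendsto_rpow_neg_atTop (neg_pos.2 hs)).comp (tendsto_natCast_atTop_atTop (R := ℝ))
  have hu0 : Tendsto u atTop (𝓝 0) :=
    hu.symm.tendsto_nhds (by simpa [Function.comp_def] using hpow.const_mul c)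
  simpa using tendsto_div_one_add (by simp) hu0

end MulRpow

end Asymptotics

section JacobiAsymptotics

variable {α β : ℝ}

theorem isEquivalent_prod_range_sub_mul_add (k : ℕ) (c : ℝ) :
    (fun n : ℕ => ∏ i ∈ Finset.range k, ((n : ℝ) - i) * (n + c + i)) ~[atTop]
      fun n : ℕ => (n : ℝ) ^ (2 * k) := by
  have h (i : ℕ) : (fun n : ℕ => ((n : ℝ) - i) * (n + c + i)) ~[atTop]
      fun n : ℕ => (n : ℝ) ^ 2 := by
    simpa only [sub_eq_add_neg, add_assoc, sq] using!
      (isEquivalent_natCast_add_const (-i : ℝ)).mul (isEquivalent_natCast_add_const (c + i))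
  have hprod := IsEquivalent.finsetProd (s := Finset.range k) fun i _ => h i
  simpa only [Finset.prod_apply, Finset.prod_const, Finset.card_range, ← pow_mul] using hprod

theorem isEquivalent_derivEval_one_jacobiP (hα : -1 < α) (hβ : -1 < β) (k : ℕ) :
    (fun n => derivEval k 1 (jacobiP α β n)) ~[atTop]
      fun n : ℕ => 1 / (2 ^ k * Real.Gamma (α + k + 1)) * (n : ℝ) ^ (2 * k + α) := by
  have h := ((isEquivalent_prod_range_sub_mul_add k (α + β + 1)).mul
    ((isEquivalent_Gamma_natCast_add (α + 1)).div
      (IsEquivalent.refl (u := fun n : ℕ => (n.factorial : ℝ))))).div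
    (IsEquivalent.refl (u := fun _ : ℕ => 2 ^ k * Real.Gamma (k + (α + 1))))
  refine (h.congr_left ?_).congr_right ?_
  · filter_upwards with n
    simp only [Pi.div_apply, Pi.mul_apply]
    rw [derivEval_one_jacobiP hα hβ]
    simp only [add_assoc]
  · filter_upwards [eventually_gt_atTop 0] with n hn
    have hn : 0 < (n : ℝ) := Nat.cast_pos.2 hn
    simp only [Pi.div_apply, Pi.mul_apply]
    rw [add_sub_cancel_right, mul_div_cancel_left₀ _ (Nat.cast_ne_zero.2 n.factorial_ne_zero),
      Real.rpow_add hn, ← Nat.cast_ofNat (R := ℝ) (n := 2), ← Nat.cast_mul, Real.rpow_natCast,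
      show (k : ℝ) + (α + 1) = α + k + 1 by ring]
    ring

theorem isEquivalent_jacobiInner_jacobiP_self (hα : -1 < α) (hβ : -1 < β) :
    (fun n => jacobiInner α β (jacobiP α β n) (jacobiP α β n)) ~[atTop]
      fun n : ℕ => 2 ^ (α + β) / (n : ℝ) := by
  have hlin : (fun n : ℕ => 2 * (n : ℝ) + (α + β + 1)) ~[atTop] fun n : ℕ => 2 * (n : ℝ) :=
    IsEquivalent.refl.add_isLittleO (((isLittleO_const_id_atTop _).comp_tendsto
      tendsto_natCast_atTop_atTop).const_mul_right two_ne_zero)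
  have h := (((IsEquivalent.refl (u := fun _ : ℕ => (2 : ℝ) ^ (α + β + 1))).mul
    (isEquivalent_Gamma_natCast_add (α + 1))).mul (isEquivalent_Gamma_natCast_add (β + 1))).div
    ((hlin.mul (IsEquivalent.refl (u := fun n : ℕ => (n.factorial : ℝ)))).mul
      (isEquivalent_Gamma_natCast_add (α + β + 1)))
  refine (h.congr_left ?_).congr_right ?_
  · filter_upwards [eventually_ne_atTop 0] with n hn
    exact (jacobiInner_jacobiP_self hα hβ hn).symm
  · filter_upwards [eventually_gt_atTop 0] with n hn
    have hn : 0 < (n : ℝ) := Nat.cast_pos.2 hn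
    simp only [Pi.div_apply, Pi.mul_apply, add_sub_cancel_right]
    rw [Real.rpow_add hn, Real.rpow_add_one two_ne_zero]
    have := Real.rpow_pos_of_pos hn α
    have := Real.rpow_pos_of_pos hn β
    field_simp

end JacobiAsymptotics

section JacobiKernel

variable {α β : ℝ}

/-- The polynomial of degree less than `n` that represents the functional `f ↦ f⁽ʲ⁾(1)` for the
Jacobi inner product on the polynomials of degree less than `n`. -/
noncomputable def jacobiKernel (hα : -1 < α) (hβ : -1 < β) (j n : ℕ) : ℝ[X] :=
  orthogonalKernel (jacobiForm hα hβ) (derivEval j 1) (jacobiP α β) n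

theorem degree_jacobiKernel_lt (hα : -1 < α) (hβ : -1 < β) (j n : ℕ) :
    (jacobiKernel hα hβ j n).degree < n :=
  degree_orthogonalKernel_lt (fun i => (isOrthogonalPoly_jacobiP hα hβ i).1) n

theorem jacobiForm_jacobiKernel (hα : -1 < α) (hβ : -1 < β) (j : ℕ) {n : ℕ} {q : ℝ[X]}
    (hq : q.degree < n) : jacobiForm hα hβ (jacobiKernel hα hβ j n) q = derivEval j 1 q :=
  orthogonalKernel_reproducing (jacobiForm_posDef hα hβ).anisotropic (jacobiForm_isSymm hα hβ)
    (isOrthogonalPoly_jacobiP hα hβ) hq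

theorem derivEval_jacobiKernel_self_nonneg (hα : -1 < α) (hβ : -1 < β) (j n : ℕ) :
    0 ≤ derivEval j 1 (jacobiKernel hα hβ j n) :=
  apply_orthogonalKernel_self_nonneg (jacobiForm_posDef hα hβ).nonneg n

theorem isEquivalent_derivEval_jacobiKernel (hα : -1 < α) (hβ : -1 < β) (j k : ℕ) :
    (fun n => derivEval k 1 (jacobiKernel hα hβ j n)) ~[atTop] fun n : ℕ =>
      1 / (2 ^ (α + β + j + k + 1) * Real.Gamma (α + j + 1) * Real.Gamma (α + k + 1) *
        (α + j + k + 1)) * (n : ℝ) ^ (2 * (α + j + k + 1)) := by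
  have : (0 : ℝ) ≤ j := j.cast_nonneg
  have : (0 : ℝ) ≤ k := k.cast_nonneg
  have hΓj : 0 < Real.Gamma (α + j + 1) := Real.Gamma_pos_of_pos (by linarith)
  have hΓk : 0 < Real.Gamma (α + k + 1) := Real.Gamma_pos_of_pos (by linarith)
  have hs : 0 < α + j + k + 1 := by linarith
  have hterm : (fun n => derivEval j 1 (jacobiP α β n) * derivEval k 1 (jacobiP α β n) /
      jacobiForm hα hβ (jacobiP α β n) (jacobiP α β n)) ~[atTop] fun n : ℕ =>
      1 / (2 ^ (α + β + j + k) * Real.Gamma (α + j + 1) * Real.Gamma (α + k + 1)) *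
        (n : ℝ) ^ (2 * (α + j + k) + 1) := by
    refine (((isEquivalent_derivEval_one_jacobiP hα hβ j).mul
      (isEquivalent_derivEval_one_jacobiP hα hβ k)).div
      (isEquivalent_jacobiInner_jacobiP_self hα hβ)).congr_right ?_
    filter_upwards [eventually_gt_atTop 0] with n hn
    have hn : 0 < (n : ℝ) := Nat.cast_pos.2 hn
    simp only [Pi.div_apply, Pi.mul_apply]
    rw [show 2 * (α + j + k) + 1 = (2 * j + α) + (2 * k + α) + 1 by ring,
      Real.rpow_add_one hn.ne', Real.rpow_add hn (2 * j + α), Real.rpow_add_natCast two_ne_zero,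
      Real.rpow_add_natCast two_ne_zero]
    field_simp
  refine ((isEquivalent_sum_range_rpow (by linarith) (by positivity) hterm).congr_left
    (.of_forall fun n => (apply_orthogonalKernel (derivEval k 1) n).symm)).congr_right ?_
  filter_upwards with n
  rw [show 2 * (α + j + k) + 1 + 1 = 2 * (α + j + k + 1) by ring, Real.rpow_add_one two_ne_zero]
  field_simp

/-- The constant `c` for which the kernel satisfies `Kₙ⁽ʲ⁾(1) ~ n ^ (2 (α + 2j + 1)) / c`. -/
noncomputable def jacobiKernelConst (α β : ℝ) (j : ℕ) : ℝ :=
  Real.Gamma (α + j + 1) ^ 2 * 2 ^ (α + β + 2 * j + 1) * (α + 2 * j + 1)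

theorem jacobiKernelConst_pos (hα : -1 < α) (β : ℝ) (j : ℕ) : 0 < jacobiKernelConst α β j := by
  have : (0 : ℝ) ≤ j := j.cast_nonneg
  have hΓ : 0 < Real.Gamma (α + j + 1) := Real.Gamma_pos_of_pos (by linarith)
  have hs : 0 < α + 2 * j + 1 := by linarith
  unfold jacobiKernelConst
  positivity

theorem isEquivalent_derivEval_jacobiKernel_self (hα : -1 < α) (hβ : -1 < β) (j : ℕ) :
    (fun n => derivEval j 1 (jacobiKernel hα hβ j n)) ~[atTop] fun n : ℕ =>
      (jacobiKernelConst α β j)⁻¹ * (n : ℝ) ^ (2 * (α + 2 * j + 1)) := by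
  refine (isEquivalent_derivEval_jacobiKernel hα hβ j j).congr_right (.of_forall fun n => ?_)
  rw [jacobiKernelConst, add_assoc (α + β), add_assoc α (j : ℝ) j, ← two_mul, one_div]
  ring_nf

theorem eventually_derivEval_one_jacobiP_ne_zero (hα : -1 < α) (hβ : -1 < β) (k : ℕ) :
    ∀ᶠ n in atTop, derivEval k 1 (jacobiP α β n) ≠ 0 := by
  have : (0 : ℝ) ≤ k := k.cast_nonneg
  have hΓ : 0 < Real.Gamma (α + k + 1) := Real.Gamma_pos_of_pos (by linarith)
  exact eventually_ne_zero_of_isEquivalent_mul_rpow (by positivity)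
    (isEquivalent_derivEval_one_jacobiP hα hβ k)

theorem eventually_derivEval_jacobiKernel_self_ne_zero (hα : -1 < α) (hβ : -1 < β) (j : ℕ) :
    ∀ᶠ n in atTop, derivEval j 1 (jacobiKernel hα hβ j n) ≠ 0 :=
  eventually_ne_zero_of_isEquivalent_mul_rpow (inv_ne_zero (jacobiKernelConst_pos hα β j).ne')
    (isEquivalent_derivEval_jacobiKernel_self hα hβ j)

theorem tendsto_derivEval_jacobiKernel_ratio (hα : -1 < α) (hβ : -1 < β) (j k : ℕ) :
    Tendsto (fun n => derivEval j 1 (jacobiP α β n) * derivEval k 1 (jacobiKernel hα hβ j n) /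
      (derivEval k 1 (jacobiP α β n) * derivEval j 1 (jacobiKernel hα hβ j n))) atTop
      (𝓝 ((α + 2 * j + 1) / (α + j + k + 1))) := by
  have : (0 : ℝ) ≤ j := j.cast_nonneg
  have : (0 : ℝ) ≤ k := k.cast_nonneg
  have hΓj : 0 < Real.Gamma (α + j + 1) := Real.Gamma_pos_of_pos (by linarith)
  have hΓk : 0 < Real.Gamma (α + k + 1) := Real.Gamma_pos_of_pos (by linarith)
  have hjk : 0 < α + j + k + 1 := by linarith
  have : 0 < α + j + j + 1 := by linarith
  have hP := isEquivalent_derivEval_one_jacobiP hα hβ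
  have hK := isEquivalent_derivEval_jacobiKernel hα hβ j
  refine IsEquivalent.tendsto_const ((((hP j).mul (hK k)).div ((hP k).mul (hK j))).congr_right ?_)
  filter_upwards [eventually_gt_atTop 0] with n hn
  have hn : 0 < (n : ℝ) := Nat.cast_pos.2 hn
  have hpow : (n : ℝ) ^ (2 * j + α) * (n : ℝ) ^ (2 * (α + j + k + 1)) =
      (n : ℝ) ^ (2 * k + α) * (n : ℝ) ^ (2 * (α + j + j + 1)) := by
    rw [← Real.rpow_add hn, ← Real.rpow_add hn]
    ring_nf
  have hpow0 := mul_pos (Real.rpow_pos_of_pos hn (2 * k + α))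
    (Real.rpow_pos_of_pos hn (2 * (α + j + j + 1)))
  simp only [Pi.div_apply, Pi.mul_apply, Function.const_apply]
  rw [mul_mul_mul_comm _ ((n : ℝ) ^ (2 * j + α)), mul_mul_mul_comm _ ((n : ℝ) ^ (2 * k + α)),
    hpow, mul_div_mul_right _ _ hpow0.ne',
    Real.rpow_add_one two_ne_zero, Real.rpow_add_one two_ne_zero,
    Real.rpow_add_natCast two_ne_zero (α + β + j) k,
    Real.rpow_add_natCast two_ne_zero (α + β + j) j]
  field_simp
  ring

theorem tendsto_derivEval_jacobiP_sq_div (hα : -1 < α) (hβ : -1 < β) (j : ℕ) :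
    Tendsto (fun n => derivEval j 1 (jacobiP α β n) ^ 2 /
      (jacobiInner α β (jacobiP α β n) (jacobiP α β n) *
        derivEval j 1 (jacobiKernel hα hβ j n))) atTop (𝓝 0) := by
  obtain ⟨c, hP⟩ : ∃ c : ℝ, (fun n => derivEval j 1 (jacobiP α β n)) ~[atTop]
      fun n : ℕ => c * (n : ℝ) ^ (2 * j + α) := ⟨_, isEquivalent_derivEval_one_jacobiP hα hβ j⟩
  have h : (fun n => derivEval j 1 (jacobiP α β n) ^ 2 /
      (jacobiInner α β (jacobiP α β n) (jacobiP α β n) *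
        derivEval j 1 (jacobiKernel hα hβ j n))) ~[atTop]
      fun n : ℕ => c ^ 2 / 2 ^ (α + β) * jacobiKernelConst α β j * (n : ℝ)⁻¹ := by
    refine ((hP.pow 2).div
      ((isEquivalent_jacobiInner_jacobiP_self hα hβ).mul
        (isEquivalent_derivEval_jacobiKernel_self hα hβ j))).congr_right ?_
    filter_upwards [eventually_gt_atTop 0] with n hn
    have hn : 0 < (n : ℝ) := Nat.cast_pos.2 hn
    have hpow : (n : ℝ) ^ (2 * (α + 2 * j + 1)) = ((n : ℝ) ^ (2 * j + α)) ^ 2 * n ^ 2 := by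
      rw [← mul_pow, ← Real.rpow_add_one hn.ne', ← Real.rpow_mul_natCast hn.le]
      ring_nf
    have := Real.rpow_pos_of_pos hn (2 * j + α)
    have hC := jacobiKernelConst_pos hα β j
    simp only [Pi.div_apply, Pi.mul_apply, Pi.pow_apply]
    rw [hpow]
    field_simp
  refine h.symm.tendsto_nhds ?_
  simpa using (tendsto_inv_atTop_nhds_zero_nat (𝕜 := ℝ)).const_mul
    (c ^ 2 / 2 ^ (α + β) * jacobiKernelConst α β j)

end JacobiKernel

section JacobiSobolev

variable {α β : ℝ}

theorem sobolevInner_eq_massForm (hα : -1 < α) (hβ : -1 < β) (j : ℕ) (m : ℝ) :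
    sobolevInner α β j m = fun f g => massForm (jacobiForm hα hβ) (derivEval j 1) m f g := by
  funext f g
  rw [massForm_apply]
  rfl

theorem one_add_mul_derivEval_jacobiKernel_self_pos (hα : -1 < α) (hβ : -1 < β) (j n : ℕ) {m : ℝ}
    (hm : 0 ≤ m) : 0 < 1 + m * derivEval j 1 (jacobiKernel hα hβ j n) :=
  add_pos_of_pos_of_nonneg one_pos
    (mul_nonneg hm (derivEval_jacobiKernel_self_nonneg hα hβ j n))

theorem sobolevQ_eq_massModification (hα : -1 < α) (hβ : -1 < β) (j n : ℕ) {m : ℝ} (hm : 0 ≤ m) :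
    sobolevQ α β j m n =
      massModification (derivEval j 1) m (jacobiKernel hα hβ j n) (jacobiP α β n) := by
  have hP := isOrthogonalPoly_jacobiP hα hβ n
  have hK := degree_jacobiKernel_lt hα hβ j n
  have hspec : IsSobolevPoly α β j m n
      (massModification (derivEval j 1) m (jacobiKernel hα hβ j n) (jacobiP α β n)) := by
    rw [IsSobolevPoly, sobolevInner_eq_massForm hα hβ]
    exact ⟨isOrthogonalPoly_massModification hP hK (fun _ => jacobiForm_jacobiKernel hα hβ j)
      (one_add_mul_derivEval_jacobiKernel_self_pos hα hβ j n hm).ne',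
      leadingCoeff_massModification hP.1 hK⟩
  have hQ : IsSobolevPoly α β j m n (sobolevQ α β j m n) := Classical.epsilon_spec ⟨_, hspec⟩
  have hlead := hQ.2.trans hspec.2.symm
  rw [IsSobolevPoly, sobolevInner_eq_massForm hα hβ] at hQ hspec
  exact hQ.1.eq_of_leadingCoeff_eq (massForm_anisotropic (jacobiForm_posDef hα hβ) hm)
    hspec.1 hlead

theorem sobolevInner_sobolevQ_self (hα : -1 < α) (hβ : -1 < β) (j n : ℕ) {m : ℝ} (hm : 0 ≤ m) :
    sobolevInner α β j m (sobolevQ α β j m n) (sobolevQ α β j m n) =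
      jacobiInner α β (jacobiP α β n) (jacobiP α β n) +
        m * derivEval j 1 (jacobiP α β n) ^ 2 /
          (1 + m * derivEval j 1 (jacobiKernel hα hβ j n)) := by
  rw [sobolevInner_eq_massForm hα hβ, sobolevQ_eq_massModification hα hβ j n hm]
  exact massForm_massModification_self (jacobiForm_isSymm hα hβ)
    (isOrthogonalPoly_jacobiP hα hβ n) (degree_jacobiKernel_lt hα hβ j n)
    (fun _ => jacobiForm_jacobiKernel hα hβ j)
    (one_add_mul_derivEval_jacobiKernel_self_pos hα hβ j n hm).ne'

variable {m : ℕ → ℝ}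

theorem tendsto_derivEval_sobolevQ_div (hα : -1 < α) (hβ : -1 < β) (j k : ℕ) (hm : ∀ n, 0 ≤ m n)
    {τ : ℝ} (hτ : Tendsto (fun n => m n * derivEval j 1 (jacobiKernel hα hβ j n) /
      (1 + m n * derivEval j 1 (jacobiKernel hα hβ j n))) atTop (𝓝 τ)) :
    Tendsto (fun n => derivEval k 1 (sobolevQ α β j (m n) n) / derivEval k 1 (jacobiP α β n))
      atTop (𝓝 (1 - (α + 2 * j + 1) / (α + j + k + 1) * τ)) := by
  simp only [sobolevQ_eq_massModification hα hβ j _ (hm _)]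
  exact tendsto_apply_massModification_div (eventually_derivEval_one_jacobiP_ne_zero hα hβ k)
    (eventually_derivEval_jacobiKernel_self_ne_zero hα hβ j)
    (tendsto_derivEval_jacobiKernel_ratio hα hβ j k) hτ

theorem tendsto_sobolevInner_sobolevQ_self_div (hα : -1 < α) (hβ : -1 < β) (j : ℕ)
    (hm : ∀ n, 0 ≤ m n) :
    Tendsto (fun n => sobolevInner α β j (m n) (sobolevQ α β j (m n) n) (sobolevQ α β j (m n) n) /
      jacobiInner α β (jacobiP α β n) (jacobiP α β n)) atTop (𝓝 1) := by
  have hbdd : IsBoundedUnder (· ≤ ·) atTop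
      (norm ∘ fun n => m n * derivEval j 1 (jacobiKernel hα hβ j n) /
        (1 + m n * derivEval j 1 (jacobiKernel hα hβ j n))) := by
    refine isBoundedUnder_of ⟨1, fun n => ?_⟩
    have hx := mul_nonneg (hm n) (derivEval_jacobiKernel_self_nonneg hα hβ j n)
    rw [Function.comp_apply, Real.norm_of_nonneg (by positivity)]
    exact div_le_one_of_le₀ (by linarith) (by linarith)
  have h := ((tendsto_derivEval_jacobiP_sq_div hα hβ j).zero_mul_isBoundedUnder_le hbdd).const_add 1
  rw [add_zero] at h
  refine h.congr' ?_
  filter_upwards [eventually_derivEval_jacobiKernel_self_ne_zero hα hβ j] with n hK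
  have hP : jacobiInner α β (jacobiP α β n) (jacobiP α β n) ≠ 0 :=
    (jacobiInner_self_pos hα hβ fun h0 => by
      simpa [h0] using (isOrthogonalPoly_jacobiP hα hβ n).1).ne'
  rw [sobolevInner_sobolevQ_self hα hβ j n (hm n), add_div, div_self hP]
  field_simp

theorem isEquivalent_mass_mul_derivEval_jacobiKernel (hα : -1 < α) (hβ : -1 < β) (j : ℕ)
    {γ M : ℝ} (hM : M ≠ 0)
    (hlim : Tendsto (fun n : ℕ => m n * (n : ℝ) ^ γ) atTop (𝓝 M)) :
    (fun n => m n * derivEval j 1 (jacobiKernel hα hβ j n)) ~[atTop] fun n : ℕ =>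
      M / jacobiKernelConst α β j * (n : ℝ) ^ (2 * (α + 2 * j + 1) - γ) := by
  refine ((isEquivalent_mul_rpow_of_tendsto hM hlim).mul
    (isEquivalent_derivEval_jacobiKernel_self hα hβ j)).congr_right ?_
  filter_upwards [eventually_gt_atTop 0] with n hn
  rw [Pi.mul_apply, mul_mul_mul_comm, ← div_eq_mul_inv, ← Real.rpow_add (Nat.cast_pos.2 hn),
    neg_add_eq_sub]

end JacobiSobolev

theorem one_sub_kernelRatio {α : ℝ} (hα : -1 < α) (j k : ℕ) :
    1 - (α + 2 * j + 1) / (α + j + k + 1) = ((k : ℝ) - j) / (α + j + k + 1) := by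
  have hs : α + j + k + 1 ≠ 0 := by linarith [j.cast_nonneg (α := ℝ), k.cast_nonneg (α := ℝ)]
  field_simp
  ring

theorem one_sub_kernelRatio_mul_eq_thetaConst {α β M : ℝ} (hα : -1 < α) (hM : 0 ≤ M) (j k : ℕ) :
    1 - (α + 2 * j + 1) / (α + j + k + 1) *
        (M / jacobiKernelConst α β j / (1 + M / jacobiKernelConst α β j)) =
      thetaConst α β M j k := by
  have hs : α + j + k + 1 ≠ 0 := by linarith [j.cast_nonneg (α := ℝ), k.cast_nonneg (α := ℝ)]
  have hc := jacobiKernelConst_pos hα β j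
  rw [thetaConst]
  change _ = (M * ((k : ℝ) - j) + jacobiKernelConst α β j * (α + j + k + 1)) /
    ((α + j + k + 1) * (M + jacobiKernelConst α β j))
  generalize jacobiKernelConst α β j = c at hc ⊢
  field_simp
  ring

theorem lemma1 (α β γ M : ℝ) (j : ℕ) (m : ℕ → ℝ)
    (hα : -1 < α) (hβ : -1 < β) (hM : 0 < M) (hm : ∀ n, 0 ≤ m n)
    (hlim : Tendsto (fun n : ℕ => m n * (n : ℝ) ^ γ) atTop (𝓝 M)) :
    (∀ k : ℕ,
      (γ < 2 * (α + 2 * j + 1) →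
        Tendsto (fun n : ℕ => (derivative^[k] (sobolevQ α β j (m n) n)).eval 1 /
            (derivative^[k] (jacobiP α β n)).eval 1) atTop
          (𝓝 (((k : ℝ) - j) / (α + j + k + 1)))) ∧
      (γ = 2 * (α + 2 * j + 1) →
        Tendsto (fun n : ℕ => (derivative^[k] (sobolevQ α β j (m n) n)).eval 1 /
            (derivative^[k] (jacobiP α β n)).eval 1) atTop
          (𝓝 (thetaConst α β M j k))) ∧
      (2 * (α + 2 * j + 1) < γ →
        Tendsto (fun n : ℕ => (derivative^[k] (sobolevQ α β j (m n) n)).eval 1 /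
            (derivative^[k] (jacobiP α β n)).eval 1) atTop (𝓝 1))) ∧
    Tendsto (fun n : ℕ =>
        sobolevInner α β j (m n) (sobolevQ α β j (m n) n) (sobolevQ α β j (m n) n) /
          jacobiInner α β (jacobiP α β n) (jacobiP α β n)) atTop (𝓝 1) := by
  refine ⟨fun k => ?_, tendsto_sobolevInner_sobolevQ_self_div hα hβ j hm⟩
  have hx := isEquivalent_mass_mul_derivEval_jacobiKernel hα hβ j hM.ne' hlim
  have hc : 0 < M / jacobiKernelConst α β j := div_pos hM (jacobiKernelConst_pos hα β j)
  have hQ {τ : ℝ} := tendsto_derivEval_sobolevQ_div (τ := τ) hα hβ j k hm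
  refine ⟨fun hγ => ?_, fun hγ => ?_, fun hγ => ?_⟩
  · rw [← one_sub_kernelRatio hα, ← mul_one ((_ + 1) / _)]
    exact hQ (tendsto_div_one_add_of_isEquivalent_mul_rpow_of_pos hc (sub_pos.2 hγ) hx)
  · simp only [hγ, sub_self, Real.rpow_zero, mul_one] at hx
    rw [← one_sub_kernelRatio_mul_eq_thetaConst hα hM.le]
    exact hQ (tendsto_div_one_add (by positivity) hx.tendsto_const)
  · have h := hQ (tendsto_div_one_add_of_isEquivalent_mul_rpow_of_neg (sub_neg.2 hγ) hx)
    rwa [mul_zero, sub_zero] at h
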